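/- Let $\mathsf h$ be a complex separable Hilbert space, $\mathcal B(\mathsf h)$ the algebra of bounded operators on $\mathsf h$, and $\mathfrak I_1(\mathsf h)$ the Banach space of trace class operators with the trace norm $\|\eta\|_1=\operatorname{tr}|\eta|$. The weak$^*$ topology of $\mathcal B(\mathsf h)$ is the one induced by the functionals $x\mapsto\operatorname{tr}(\eta x)$, $\eta\in\mathfrak I_1(\mathsf h)$. A quantum Markov semigroup (QMS) is a weak$^*$-continuous semigroup $\mathcal T=(\mathcal T_t)_{t\ge 0}$ of completely positive, identity preserving, normal (i.e. weak$^*$-continuous) linear maps on $\mathcal B(\mathsf h)$; its predual semigroup $(\mathcal T_{*t})_{t\ge0}$ on $\mathfrak I_1(\mathsf h)$ is determined by $\operatorname{tr}(\mathcal T_{*t}(\eta)x)=\operatorname{tr}(\eta\,\mathcal T_t(x))$ for all $x\in\mathcal B(\mathsf h)$. A density is a positive trace class operator of trace one; it is faithful if its range is dense in $\mathsf h$, and invariant if $\mathcal T_{*t}(\rho)=\rho$ for all $t\ge 0$. The QMS $\mathcal T$ is primitive if it has a unique faithful invariant density. **Theorem.** Let $\mathcal T$ be a primitive QMS and let $\rho$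 be its unique faithful invariant density. Then, for every density $\eta$ and every $t>0$, the function $s\mapsto\mathcal T_{*s}(\eta)$ is (Bochner) integrable on $[0,t]$ with values in $\mathfrak I_1(\mathsf h)$, the Cesàro mean $\frac1t\int_0^t\mathcal T_{*s}(\eta)\,ds$ is a density, and $$\lim_{t\to\infty}\Big\|\frac1t\int_0^t\mathcal T_{*s}(\eta)\,ds-\rho\Big\|_1=0 .$$ -/

import Mathlib

open scoped ENNReal NNReal InnerProductSpace

noncomputable section

namespace QuantumMarkov

variable {H : Type*} [NormedAddCommGroup H] [InnerProductSpace ℂ H] [CompleteSpace H]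

variable (H) in
/-- The index set of a fixed orthonormal basis of `H`. -/
def basisIndex : Set H := (exists_hilbertBasis ℂ H).choose

variable (H) in
/-- A fixed orthonormal (Hilbert) basis `(eᵢ)` of `H`, in which traces are computed (their values do
not depend on this choice). -/
def basis : HilbertBasis (basisIndex H) ℂ H := (exists_hilbertBasis ℂ H).choose_spec.choose

/-- `A` is trace class if `∑ᵢ ⟨eᵢ, |A| eᵢ⟩ < ∞`, where `|A| = (A* A)^{1/2}`. -/
def IsTraceClass (A : H →L[ℂ] H) : Prop :=
  Summable fun i => (⟪basis H i, CFC.abs A (basis H i)⟫_ℂ).re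

/-- The trace norm `‖A‖₁ = tr |A| = ∑ᵢ ⟨eᵢ, |A| eᵢ⟩`. -/
def traceNorm (A : H →L[ℂ] H) : ℝ :=
  ∑' i, (⟪basis H i, CFC.abs A (basis H i)⟫_ℂ).re

section Helpers

lemma polar (A : H →L[ℂ] H) : ∃ U : H →L[ℂ] H, ‖U‖ ≤ 1 ∧ U * CFC.abs A = A ∧
    star U * A = CFC.abs A := by
  set P := CFC.abs A with hP
  have hPs : star P = P := (CFC.abs_nonneg A).isSelfAdjoint.star_eq
  have hin : ∀ x y, ⟪A x, A y⟫_ℂ = ⟪P x, P y⟫_ℂ := by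
    intro x y
    have h := CFC.abs_mul_abs A
    rw [← ContinuousLinearMap.adjoint_inner_right, ← ContinuousLinearMap.adjoint_inner_right]
    have h1 := congrArg (fun f : H →L[ℂ] H => f y) h
    simp only [← hP] at h1
    rw [← ContinuousLinearMap.star_eq_adjoint, ← ContinuousLinearMap.star_eq_adjoint, hPs]
    exact congrArg _ h1.symm
  have hnorm : ∀ x, ‖A x‖ = ‖P x‖ := by
    intro x
    have h := hin x x
    rw [inner_self_eq_norm_sq_to_K, inner_self_eq_norm_sq_to_K] at h
    have h2 : ‖A x‖ ^ 2 = ‖P x‖ ^ 2 := by exact_mod_cast h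
    exact (sq_eq_sq₀ (norm_nonneg _) (norm_nonneg _)).1 h2
  set K : Submodule ℂ H := (LinearMap.range P.toLinearMap).topologicalClosure with hK
  have hmem : ∀ x, P x ∈ K := fun x => Submodule.le_topologicalClosure _ ⟨x, rfl⟩
  have : CompleteSpace K :=
    (Submodule.isClosed_topologicalClosure _).completeSpace_coe
  set e : H →ₗ[ℂ] K := P.toLinearMap.codRestrict K hmem with he
  have hd : DenseRange e := by
    intro y
    rw [closure_subtype]
    have hy : (y : H) ∈ closure (LinearMap.range P.toLinearMap : Set H) := y.2
    convert hy using 2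
    ext z
    constructor
    · rintro ⟨_, ⟨w, rfl⟩, rfl⟩; exact ⟨w, rfl⟩
    · rintro ⟨w, rfl⟩; exact ⟨e w, ⟨w, rfl⟩, rfl⟩
  have hb : ∀ x, ‖A.toLinearMap x‖ ≤ 1 * ‖e x‖ := by
    intro x; rw [one_mul]; exact (hnorm x).le
  set V := A.toLinearMap.extendOfNorm e with hV
  have hVe : ∀ x, V (e x) = A x := fun x => LinearMap.extendOfNorm_eq hd ⟨1, hb⟩ x
  refine ⟨V ∘L K.orthogonalProjectionOnto, ?_, ?_, ?_⟩
  · refine (ContinuousLinearMap.opNorm_comp_le _ _).trans ?_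
    exact mul_le_one₀ (LinearMap.opNorm_extendOfNorm_le hd zero_le_one hb) (norm_nonneg _)
      (Submodule.orthogonalProjectionOnto_norm_le K)
  · ext x
    change V (K.orthogonalProjectionOnto (P x)) = A x
    rw [← hVe]
    congr 1
    exact Submodule.orthogonalProjectionOnto_mem_subspace_eq_self (⟨P x, hmem x⟩ : K)
  · ext x
    refine ext_inner_right ℂ fun y => ?_
    change ⟪star (V ∘L K.orthogonalProjectionOnto) (A x), y⟫_ℂ = ⟪P x, y⟫_ℂ
    rw [ContinuousLinearMap.star_eq_adjoint, ContinuousLinearMap.adjoint_inner_left]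
    change ⟪A x, V (K.orthogonalProjectionOnto y)⟫_ℂ = _
    have key : ∀ z : K, ⟪A x, V z⟫_ℂ = ⟪P x, (z : H)⟫_ℂ := by
      intro z
      refine hd.induction_on (p := fun z : K => ⟪A x, V z⟫_ℂ = ⟪P x, (z : H)⟫_ℂ) z ?_ ?_
      · exact isClosed_eq (by fun_prop) (by fun_prop)
      · intro w; rw [hVe, hin]; rfl
    rw [key]
    exact Submodule.inner_orthogonalProjectionOnto_eq_of_mem_left (⟨P x, hmem x⟩ : K) y

/-- Sum of the squares of the column norms (the squared Hilbert--Schmidt norm). -/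
def hsSq (C : H →L[ℂ] H) : ℝ≥0∞ := ∑' i, ‖C (basis H i)‖ₑ ^ 2

lemma enorm_sq_eq_tsum (x : H) : ‖x‖ₑ ^ 2 = ∑' j, ‖⟪basis H j, x⟫_ℂ‖ₑ ^ 2 := by
  have h := (basis H).hasSum_inner_mul_inner x x
  have h2 : HasSum (fun j => ‖⟪basis H j, x⟫_ℂ‖ ^ 2) (‖x‖ ^ 2) := by
    have := Complex.hasSum_re h
    rw [inner_self_eq_norm_sq_to_K] at this
    convert this using 1
    · ext j
      rw [← inner_conj_symm x, RCLike.conj_mul]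
      norm_cast
    · norm_cast
  have h3 : ∀ y : ℝ, 0 ≤ y → ENNReal.ofReal (y ^ 2) = (ENNReal.ofReal y) ^ 2 := fun y hy =>
    ENNReal.ofReal_pow hy 2
  rw [← ofReal_norm, ← h3 _ (norm_nonneg _), ← h2.tsum_eq,
    ENNReal.ofReal_tsum_of_nonneg (fun _ => by positivity) h2.summable]
  simp_rw [h3 _ (norm_nonneg _), ofReal_norm]

lemma hsSq_star (C : H →L[ℂ] H) : hsSq (star C) = hsSq C := by
  unfold hsSq
  rw [tsum_congr fun i => enorm_sq_eq_tsum ((star C) (basis H i)),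
    tsum_congr fun i => enorm_sq_eq_tsum (C (basis H i)), ENNReal.tsum_comm]
  refine tsum_congr fun i => tsum_congr fun j => ?_
  rw [ContinuousLinearMap.star_eq_adjoint, ContinuousLinearMap.adjoint_inner_right,
    ← inner_conj_symm, RCLike.enorm_conj]

lemma hsSq_mul_le (X C : H →L[ℂ] H) : hsSq (X * C) ≤ ‖X‖ₑ ^ 2 * hsSq C := by
  unfold hsSq
  rw [← ENNReal.tsum_mul_left]
  refine ENNReal.tsum_le_tsum fun i => ?_
  rw [← mul_pow]
  gcongr
  exact X.le_opENorm _

lemma hsSq_mul_le' (X C : H →L[ℂ] H) : hsSq (C * X) ≤ ‖X‖ₑ ^ 2 * hsSq C := by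
  rw [← hsSq_star, star_mul, ← hsSq_star C]
  refine (hsSq_mul_le _ _).trans_eq ?_
  rw [enorm_eq_nnnorm, nnnorm_star, enorm_eq_nnnorm]

lemma inner_star_mul (F G : H →L[ℂ] H) (x : H) : ⟪x, (star F * G) x⟫_ℂ = ⟪F x, G x⟫_ℂ := by
  rw [ContinuousLinearMap.star_eq_adjoint]
  exact ContinuousLinearMap.adjoint_inner_right F x (G x)

lemma tsum_inner_le (X C Y : H →L[ℂ] H) (hC : star C = C) :
    2 * ∑' i, ‖⟪basis H i, (X * (C * C) * Y) (basis H i)⟫_ℂ‖ₑ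
      ≤ (‖X‖ₑ ^ 2 + ‖Y‖ₑ ^ 2) * hsSq C := by
  have h1 : ∀ i, 2 * ‖⟪basis H i, (X * (C * C) * Y) (basis H i)⟫_ℂ‖ₑ
      ≤ ‖(C * star X) (basis H i)‖ₑ ^ 2 + ‖(C * Y) (basis H i)‖ₑ ^ 2 := by
    intro i
    generalize (basis H i : H) = b
    have h2 : ⟪b, (X * (C * C) * Y) b⟫_ℂ = ⟪(C * star X) b, (C * Y) b⟫_ℂ := by
      have : X * (C * C) * Y = star (C * star X) * (C * Y) := by
        rw [star_mul, star_star, hC]; simp only [mul_assoc]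
      rw [this, inner_star_mul]
    have h3 : 2 * ‖⟪b, (X * (C * C) * Y) b⟫_ℂ‖ ≤ ‖(C * star X) b‖ ^ 2 + ‖(C * Y) b‖ ^ 2 := by
      rw [h2]
      have := norm_inner_le_norm (𝕜 := ℂ) ((C * star X) b) ((C * Y) b)
      nlinarith [sq_nonneg (‖(C * star X) b‖ - ‖(C * Y) b‖)]
    have h4 := ENNReal.ofReal_le_ofReal h3
    rw [ENNReal.ofReal_mul (by norm_num), ENNReal.ofReal_add (by positivity) (by positivity),
      ENNReal.ofReal_pow (norm_nonneg _), ENNReal.ofReal_pow (norm_nonneg _)] at h4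
    simpa only [ofReal_norm, ENNReal.ofReal_ofNat] using h4
  rw [← ENNReal.tsum_mul_left]
  refine (ENNReal.tsum_le_tsum h1).trans ?_
  rw [ENNReal.tsum_add, add_mul]
  refine add_le_add ?_ (hsSq_mul_le' Y C)
  refine (hsSq_mul_le' (star X) C).trans_eq ?_
  rw [enorm_eq_nnnorm, nnnorm_star, enorm_eq_nnnorm]

/-- The trace norm with values in `[0, ∞]`. -/
def eTraceNorm (A : H →L[ℂ] H) : ℝ≥0∞ :=
  ∑' i, ENNReal.ofReal (⟪basis H i, CFC.abs A (basis H i)⟫_ℂ).re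

lemma re_inner_abs_nonneg (A : H →L[ℂ] H) (x : H) : 0 ≤ (⟪x, CFC.abs A x⟫_ℂ).re := by
  have h := (ContinuousLinearMap.nonneg_iff_isPositive _).1 (CFC.abs_nonneg A)
  exact h.re_inner_nonneg_right x

lemma isTraceClass_iff {A : H →L[ℂ] H} : IsTraceClass A ↔ eTraceNorm A ≠ ∞ := by
  constructor
  · intro h
    exact h.tsum_ofReal_ne_top
  · intro h
    have := ENNReal.summable_toReal h
    refine this.congr fun i => ?_
    rw [ENNReal.toReal_ofReal (re_inner_abs_nonneg _ _)]

lemma traceNorm_eq (A : H →L[ℂ] H) : traceNorm A = (eTraceNorm A).toReal := by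
  unfold traceNorm eTraceNorm
  rw [ENNReal.tsum_toReal_eq (fun _ => ENNReal.ofReal_ne_top)]
  exact tsum_congr fun i => (ENNReal.toReal_ofReal (re_inner_abs_nonneg _ _)).symm

lemma exists_factor (A : H →L[ℂ] H) : ∃ U C : H →L[ℂ] H, ‖U‖ₑ ≤ 1 ∧ star C = C ∧
    A = U * (C * C) ∧ star U * A = CFC.abs A ∧ CFC.abs A = C * C ∧ eTraceNorm A = hsSq C := by
  obtain ⟨U, hU, h1, h2⟩ := polar A
  have hC : star (CFC.sqrt (CFC.abs A)) = CFC.sqrt (CFC.abs A) :=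
    (CFC.sqrt_nonneg _).isSelfAdjoint.star_eq
  have hCC : CFC.sqrt (CFC.abs A) * CFC.sqrt (CFC.abs A) = CFC.abs A :=
    CFC.sqrt_mul_sqrt_self _ (CFC.abs_nonneg A)
  refine ⟨U, CFC.sqrt (CFC.abs A), ?_, hC, ?_, h2, hCC.symm, ?_⟩
  · rw [← ofReal_norm]; exact ENNReal.ofReal_le_one.2 hU
  · rw [hCC, h1]
  · unfold eTraceNorm hsSq
    refine tsum_congr fun i => ?_
    conv_lhs => rw [← hCC]
    set C := CFC.sqrt (CFC.abs A)
    have : ⟪basis H i, (C * C) (basis H i)⟫_ℂ = ⟪C (basis H i), C (basis H i)⟫_ℂ := by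
      rw [← inner_star_mul, hC]
    rw [this, inner_self_eq_norm_sq_to_K, ← ofReal_norm, ← ENNReal.ofReal_pow (norm_nonneg _)]
    norm_cast

lemma ofReal_re_le_enorm (z : ℂ) : ENNReal.ofReal z.re ≤ ‖z‖ₑ := by
  rw [← ofReal_norm]
  exact ENNReal.ofReal_le_ofReal (Complex.re_le_norm z)

lemma eTraceNorm_add_le (A B : H →L[ℂ] H) :
    eTraceNorm (A + B) ≤ eTraceNorm A + eTraceNorm B := by
  obtain ⟨V, -, hV, -, -, hVs, -, -⟩ := exists_factor (A + B)
  have key : ∀ A : H →L[ℂ] H,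
      ∑' i, ‖⟪basis H i, (star V * A) (basis H i)⟫_ℂ‖ₑ ≤ eTraceNorm A := by
    intro A
    obtain ⟨U, C, hU, hC, hA, -, -, hN⟩ := exists_factor A
    have h := tsum_inner_le (star V * U) C 1 hC
    have h1 : star V * U * (C * C) * 1 = star V * A := by rw [hA, mul_one, mul_assoc]
    have h2 : ‖star V * U‖ₑ ≤ 1 := by
      rw [← ofReal_norm] at hV hU ⊢
      rw [ENNReal.ofReal_le_one] at hV hU ⊢
      refine (norm_mul_le _ _).trans (mul_le_one₀ ?_ (norm_nonneg _) hU)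
      rwa [norm_star]
    have h3 : ‖(1 : H →L[ℂ] H)‖ₑ ≤ 1 := by
      rw [← ofReal_norm, ENNReal.ofReal_le_one]
      exact ContinuousLinearMap.norm_id_le
    rw [h1, ← hN] at h
    have h4 : 2 * ∑' i, ‖⟪basis H i, (star V * A) (basis H i)⟫_ℂ‖ₑ ≤ 2 * eTraceNorm A := by
      refine h.trans ?_
      gcongr
      calc ‖star V * U‖ₑ ^ 2 + ‖(1 : H →L[ℂ] H)‖ₑ ^ 2 ≤ 1 ^ 2 + 1 ^ 2 := by gcongr
        _ = 2 := by norm_num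
    exact (ENNReal.mul_le_mul_iff_right (by norm_num) (by norm_num)).1 h4
  refine le_trans ?_ (add_le_add (key A) (key B))
  rw [← ENNReal.tsum_add, eTraceNorm]
  refine ENNReal.tsum_le_tsum fun i => ?_
  rw [← hVs]
  refine (ofReal_re_le_enorm _).trans ?_
  rw [mul_add, add_apply, inner_add_right]
  exact enorm_add_le _ _

lemma eTraceNorm_smul (c : ℂ) (A : H →L[ℂ] H) : eTraceNorm (c • A) = ‖c‖ₑ * eTraceNorm A := by
  unfold eTraceNorm
  rw [← ENNReal.tsum_mul_left]
  refine tsum_congr fun i => ?_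
  rw [CFC.abs_smul, ← ofReal_norm, ← ENNReal.ofReal_mul (norm_nonneg _)]
  congr 1
  rw [smul_apply, ← Complex.coe_smul, inner_smul_right]
  simp

lemma enorm_le_eTraceNorm (A : H →L[ℂ] H) : ‖A‖ₑ ≤ eTraceNorm A := by
  obtain ⟨U, C, hU, hC, hA, -, -, hN⟩ := exists_factor A
  rw [hN]
  by_cases hfin : hsSq C = ∞
  · rw [hfin]; exact le_top
  have h1 : ∀ x, ‖C x‖ₑ ^ 2 ≤ hsSq C * ‖x‖ₑ ^ 2 := by
    intro x
    rw [enorm_sq_eq_tsum, hsSq, ← ENNReal.tsum_mul_right]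
    refine ENNReal.tsum_le_tsum fun j => ?_
    rw [← mul_pow]
    gcongr
    have h2 : ⟪basis H j, C x⟫_ℂ = ⟪C (basis H j), x⟫_ℂ := by
      conv_lhs => rw [← hC, ContinuousLinearMap.star_eq_adjoint]
      exact ContinuousLinearMap.adjoint_inner_right C _ _
    rw [h2, ← ofReal_norm, ← ofReal_norm, ← ofReal_norm, ← ENNReal.ofReal_mul (norm_nonneg _)]
    exact ENNReal.ofReal_le_ofReal (norm_inner_le_norm _ _)
  set r := (hsSq C).toReal with hr
  have h2 : ‖C‖ ≤ √r := by
    refine ContinuousLinearMap.opNorm_le_bound _ (Real.sqrt_nonneg _) fun x => ?_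
    have h3 := ENNReal.toReal_mono (by finiteness) (h1 x)
    rw [ENNReal.toReal_mul, ENNReal.toReal_pow, ENNReal.toReal_pow, toReal_enorm, toReal_enorm,
      ← hr] at h3
    refine Real.le_sqrt_of_sq_le h3 |>.trans_eq ?_
    rw [Real.sqrt_mul' _ (by positivity), Real.sqrt_sq (norm_nonneg _)]
  have h3 : ‖A‖ ≤ r := by
    rw [← ofReal_norm, ENNReal.ofReal_le_one] at hU
    calc ‖A‖ ≤ ‖U‖ * (‖C‖ * ‖C‖) := by
          rw [hA]
          exact (norm_mul_le _ _).trans (by gcongr; exact norm_mul_le _ _)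
      _ ≤ 1 * (√r * √r) := by gcongr
      _ = r := by rw [one_mul, Real.mul_self_sqrt ENNReal.toReal_nonneg]
  rw [← ofReal_norm]
  exact ENNReal.ofReal_le_of_le_toReal h3

lemma lowerSemicontinuous_eTraceNorm :
    LowerSemicontinuous (eTraceNorm : (H →L[ℂ] H) → ℝ≥0∞) := by
  refine lowerSemicontinuous_tsum fun i => Continuous.lowerSemicontinuous ?_
  have : Continuous (CFC.abs : (H →L[ℂ] H) → (H →L[ℂ] H)) := CFC.continuous_abs
  exact ENNReal.continuous_ofReal.comp (Complex.continuous_re.comp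
    (Continuous.inner continuous_const (this.clm_apply continuous_const)))

lemma IsTraceClass.mul_right {A : H →L[ℂ] H} (hA : IsTraceClass A) (x : H →L[ℂ] H) :
    IsTraceClass (A * x) := by
  rw [isTraceClass_iff] at hA ⊢
  obtain ⟨V, -, hV, -, -, hVs, -, -⟩ := exists_factor (A * x)
  obtain ⟨U, C, hU, hC, hA', -, -, hN⟩ := exists_factor A
  have h := tsum_inner_le (star V * U) C x hC
  have h1 : star V * U * (C * C) * x = CFC.abs (A * x) := by
    rw [← hVs, hA']; simp only [mul_assoc]
  rw [h1, ← hN] at h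
  have h2 : eTraceNorm (A * x) ≤
      2 * ∑' i, ‖⟪basis H i, CFC.abs (A * x) (basis H i)⟫_ℂ‖ₑ := by
    refine le_trans (ENNReal.tsum_le_tsum fun i => ofReal_re_le_enorm _) ?_
    exact le_mul_of_one_le_left zero_le (by norm_num)
  refine ne_top_of_le_ne_top ?_ (h2.trans h)
  finiteness

lemma IsTraceClass.summable_inner {A : H →L[ℂ] H} (hA : IsTraceClass A) :
    Summable fun i => ⟪basis H i, A (basis H i)⟫_ℂ := by
  rw [isTraceClass_iff] at hA
  obtain ⟨U, C, hU, hC, hA', -, -, hN⟩ := exists_factor A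
  have h := tsum_inner_le U C 1 hC
  rw [mul_one, ← hA', ← hN] at h
  have h2 : ∑' i, ‖⟪basis H i, A (basis H i)⟫_ℂ‖ₑ ≠ ∞ := by
    intro h3
    rw [h3, ENNReal.mul_top (by norm_num), top_le_iff] at h
    exact absurd h (by finiteness)
  refine Summable.of_norm ?_
  refine (ENNReal.summable_toReal h2).congr fun i => ?_
  exact toReal_enorm _

end Helpers

variable (H) in
/-- The linear space of trace class operators. -/
def traceClassSubmodule : Submodule ℂ (H →L[ℂ] H) where
  carrier := {A | IsTraceClass A}
  add_mem' {A B} hA hB := by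
    rw [Set.mem_ofPred_eq, isTraceClass_iff] at *
    exact ne_top_of_le_ne_top (ENNReal.add_ne_top.2 ⟨hA, hB⟩) (eTraceNorm_add_le A B)
  zero_mem' := by
    rw [Set.mem_ofPred_eq, isTraceClass_iff]
    simp [eTraceNorm]
  smul_mem' c A hA := by
    rw [Set.mem_ofPred_eq, isTraceClass_iff] at *
    rw [eTraceNorm_smul]
    finiteness

variable (H) in
/-- The space `𝔗₁(H)` of trace class operators; it carries the trace norm (not the operator norm),
see the instances below. -/
def TraceClass : Type _ := traceClassSubmodule H

namespace TraceClass

instance : AddCommGroup (TraceClass H) := inferInstanceAs (AddCommGroup (traceClassSubmodule H))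

instance : Module ℂ (TraceClass H) := inferInstanceAs (Module ℂ (traceClassSubmodule H))

/-- The underlying bounded operator, as a linear inclusion `𝔗₁(H) → B(H)`. -/
def toOp : TraceClass H →ₗ[ℂ] (H →L[ℂ] H) := (traceClassSubmodule H).subtype

lemma isTraceClass (η : TraceClass H) : IsTraceClass (toOp η) := η.2

lemma toOp_injective : Function.Injective (toOp : TraceClass H → (H →L[ℂ] H)) :=
  Subtype.val_injective

/-- A trace class operator as an element of `TraceClass H`. -/
def mk (A : H →L[ℂ] H) (hA : IsTraceClass A) : TraceClass H := ⟨A, hA⟩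

@[simp] lemma toOp_mk (A : H →L[ℂ] H) (hA : IsTraceClass A) : toOp (mk A hA) = A := rfl

instance : Norm (TraceClass H) := ⟨fun η => traceNorm (toOp η)⟩

lemma norm_def (η : TraceClass H) : ‖η‖ = traceNorm (toOp η) := rfl

lemma core : NormedSpace.Core ℂ (TraceClass H) where
  norm_nonneg η := by rw [norm_def, traceNorm_eq]; exact ENNReal.toReal_nonneg
  norm_smul c η := by
    rw [norm_def, norm_def, traceNorm_eq, traceNorm_eq, map_smul, eTraceNorm_smul,
      ENNReal.toReal_mul, toReal_enorm]
  norm_triangle η ζ := by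
    simp only [norm_def, traceNorm_eq, map_add]
    have h1 := isTraceClass_iff.1 η.isTraceClass
    have h2 := isTraceClass_iff.1 ζ.isTraceClass
    rw [← ENNReal.toReal_add h1 h2]
    exact ENNReal.toReal_mono (ENNReal.add_ne_top.2 ⟨h1, h2⟩) (eTraceNorm_add_le _ _)
  norm_eq_zero_iff η := by
    constructor
    · intro h
      rw [norm_def, traceNorm_eq, ENNReal.toReal_eq_zero_iff] at h
      rcases h with h | h
      · have h1 := enorm_le_eTraceNorm (toOp η)
        rw [h, le_zero_iff, enorm_eq_zero] at h1
        exact toOp_injective (by rw [h1, map_zero])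
      · exact absurd h (isTraceClass_iff.1 η.isTraceClass)
    · rintro rfl
      rw [norm_def, traceNorm_eq, map_zero]
      simp [eTraceNorm]

instance : NormedAddCommGroup (TraceClass H) := NormedAddCommGroup.ofCore core

instance : NormedSpace ℂ (TraceClass H) := NormedSpace.ofCore core

lemma eTraceNorm_toOp (η : TraceClass H) : eTraceNorm (toOp η) = ENNReal.ofReal ‖η‖ := by
  rw [norm_def, traceNorm_eq, ENNReal.ofReal_toReal (isTraceClass_iff.1 η.isTraceClass)]

lemma norm_toOp_le (η : TraceClass H) : ‖toOp η‖ ≤ ‖η‖ := by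
  have h := enorm_le_eTraceNorm (toOp η)
  rw [eTraceNorm_toOp, ← ofReal_norm] at h
  exact (ENNReal.ofReal_le_ofReal_iff (norm_nonneg _)).1 h

instance : CompleteSpace (TraceClass H) := by
  refine Metric.complete_of_cauchySeq_tendsto fun u hu => ?_
  have hu' : CauchySeq fun n => toOp (u n) := by
    rw [Metric.cauchySeq_iff] at hu ⊢
    intro ε hε
    obtain ⟨N, hN⟩ := hu ε hε
    refine ⟨N, fun m hm n hn => lt_of_le_of_lt ?_ (hN m hm n hn)⟩
    rw [dist_eq_norm, dist_eq_norm, ← map_sub]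
    exact norm_toOp_le _
  obtain ⟨A, hA⟩ := cauchySeq_tendsto_of_complete hu'
  have key : ∀ ε > 0, ∃ N, ∀ n ≥ N, eTraceNorm (A - toOp (u n)) ≤ ENNReal.ofReal ε := by
    intro ε hε
    obtain ⟨N, hN⟩ := Metric.cauchySeq_iff.1 hu ε hε
    refine ⟨N, fun n hn => ?_⟩
    have hcl := lowerSemicontinuous_eTraceNorm (H := H) |>.isClosed_preimage (ENNReal.ofReal ε)
    refine hcl.mem_of_tendsto (hA.sub_const (toOp (u n))) ?_
    filter_upwards [Filter.eventually_ge_atTop N] with m hm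
    have h := (hN m hm n hn).le
    rw [Set.mem_preimage, Set.mem_Iic, ← map_sub, eTraceNorm_toOp]
    rw [dist_eq_norm] at h
    exact ENNReal.ofReal_le_ofReal h
  obtain ⟨N, hN⟩ := key 1 one_pos
  have h1 : IsTraceClass (A - toOp (u N)) :=
    isTraceClass_iff.2 (ne_top_of_le_ne_top ENNReal.ofReal_ne_top (hN N le_rfl))
  have h2 : IsTraceClass A := by
    have := (traceClassSubmodule H).add_mem h1 (u N).isTraceClass
    rwa [sub_add_cancel] at this
  refine ⟨mk A h2, Metric.tendsto_atTop'.2 fun ε hε => ?_⟩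
  obtain ⟨M, hM⟩ := key (ε / 2) (by positivity)
  refine ⟨M, fun n hn => ?_⟩
  have h3 := hM n hn.le
  have h4 : A - toOp (u n) = toOp (mk A h2 - u n) := by rw [map_sub, toOp_mk]
  rw [h4, eTraceNorm_toOp, ENNReal.ofReal_le_ofReal_iff (by positivity)] at h3
  rw [dist_comm, dist_eq_norm]
  linarith

/-- The trace `tr η = ∑ᵢ ⟨eᵢ, η eᵢ⟩`. -/
def trace : TraceClass H →ₗ[ℂ] ℂ where
  toFun η := ∑' i, ⟪basis H i, toOp η (basis H i)⟫_ℂ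
  map_add' η ζ := by
    rw [← η.isTraceClass.summable_inner.tsum_add ζ.isTraceClass.summable_inner]
    refine tsum_congr fun i => ?_
    rw [map_add, add_apply, inner_add_right]
  map_smul' c η := by
    rw [RingHom.id_apply, smul_eq_mul, ← tsum_mul_left]
    refine tsum_congr fun i => ?_
    rw [map_smul, smul_apply, inner_smul_right]

/-- The product `η x` of a trace class operator `η` and a bounded operator `x`. -/
def mulOp (η : TraceClass H) (x : H →L[ℂ] H) : TraceClass H :=
  mk (toOp η * x) (η.isTraceClass.mul_right x)

end TraceClass

variable (H) in
/-- The duality `(x, η) ↦ tr (η x)` between `B(H)` and the trace class operators. -/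
def pairing : (H →L[ℂ] H) →ₗ[ℂ] TraceClass H →ₗ[ℂ] ℂ :=
  LinearMap.mk₂ ℂ (fun x η => (η.mulOp x).trace)
    (fun x y η => by
      rw [← map_add]; congr 1; apply TraceClass.toOp_injective
      simp [TraceClass.mulOp, mul_add])
    (fun c x η => by
      rw [← map_smul]; congr 1; apply TraceClass.toOp_injective
      simp only [TraceClass.mulOp, TraceClass.toOp_mk, map_smul, mul_smul_comm])
    (fun x η ζ => by
      rw [← map_add]; rfl)
    (fun c x η => by
      rw [← map_smul]; rfl)

variable (H) in
/-- `B(H)` with the weak* topology `σ(B(H), 𝔗₁(H))`. -/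
abbrev WeakStarOp : Type _ := WeakBilin (pairing H)

/-- The identity map, `B(H)` to `B(H)` with the weak* topology. -/
def toWeakStar : (H →L[ℂ] H) ≃ₗ[ℂ] WeakStarOp H := LinearEquiv.refl ℂ (H →L[ℂ] H)

/-- A linear map of `B(H)` is normal if it is continuous for the weak* topology. -/
def IsNormalMap (Φ : (H →L[ℂ] H) →ₗ[ℂ] (H →L[ℂ] H)) : Prop :=
  Continuous fun x : WeakStarOp H => toWeakStar (Φ (toWeakStar.symm x))

variable (H) in
/-- A quantum Markov semigroup on `B(H)`: a weak*-continuous semigroup of completely positive,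
identity preserving, normal linear maps. -/
structure QuantumMarkovSemigroup where
  /-- The maps `𝒯ₜ`, `t ≥ 0`, completely positive by type. -/
  map : ℝ≥0 → CompletelyPositiveMap (H →L[ℂ] H) (H →L[ℂ] H)
  map_zero : ∀ x, map 0 x = x
  map_add : ∀ s t x, map (s + t) x = map s (map t x)
  map_one : ∀ t, map t 1 = 1
  normal : ∀ t, IsNormalMap (map t).toLinearMap
  weakStar_continuous : ∀ x, Continuous fun t => toWeakStar (map t x)

namespace QuantumMarkovSemigroup

variable (T : QuantumMarkovSemigroup H)

lemma exists_predual (t : ℝ≥0) (η : TraceClass H) :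
    ∃ ζ : TraceClass H, ∀ x, (ζ.mulOp x).trace = (η.mulOp (T.map t x)).trace := by
  let f : StrongDual ℂ (WeakStarOp H) :=
    (WeakBilin.eval (pairing H) η).comp
      ⟨toWeakStar.toLinearMap ∘ₗ (T.map t).toLinearMap ∘ₗ toWeakStar.symm.toLinearMap, T.normal t⟩
  obtain ⟨ζ, hζ⟩ := LinearMap.dualEmbedding_surjective (pairing H) f
  exact ⟨ζ, fun x => congrArg (fun g : StrongDual ℂ (WeakStarOp H) => g (toWeakStar x)) hζ⟩

/-- The predual semigroup `𝒯_{*t}` on the trace class operators: `𝒯_{*t}(η)` is the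
trace class operator with `tr (𝒯_{*t}(η) x) = tr (η 𝒯ₜ(x))` for all `x ∈ B(H)`. -/
def predual (t : ℝ≥0) (η : TraceClass H) : TraceClass H := (T.exists_predual t η).choose

lemma trace_predual_mulOp (t : ℝ≥0) (η : TraceClass H) (x : H →L[ℂ] H) :
    ((T.predual t η).mulOp x).trace = (η.mulOp (T.map t x)).trace :=
  (T.exists_predual t η).choose_spec x

end QuantumMarkovSemigroup

/-- A trace class operator is determined by its pairing with `B(H)`; in particular the predual
maps above are uniquely determined. -/
lemma eq_of_trace_mulOp_eq {η ζ : TraceClass H}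
    (h : ∀ x, (η.mulOp x).trace = (ζ.mulOp x).trace) : η = ζ := by
  apply TraceClass.toOp_injective
  have key : ∀ (η : TraceClass H) (u v : H), (η.mulOp (InnerProductSpace.rankOne ℂ u v)).trace =
      ⟪v, η.toOp u⟫_ℂ := by
    intro η u v
    change ∑' i, ⟪basis H i, η.toOp ((InnerProductSpace.rankOne ℂ u v) (basis H i))⟫_ℂ = _
    rw [← (basis H).tsum_inner_mul_inner v (η.toOp u)]
    refine tsum_congr fun i => ?_
    rw [InnerProductSpace.rankOne_apply, map_smul, inner_smul_right]
  ext u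
  refine ext_inner_left ℂ fun v => ?_
  rw [← key, ← key, h]

/-- A density: a positive trace class operator of unit trace. -/
structure IsDensity (ρ : TraceClass H) : Prop where
  nonneg : 0 ≤ ρ.toOp
  trace_eq_one : ρ.trace = 1

/-- The support (closure of the range) is the whole space. -/
def IsFaithful (ρ : TraceClass H) : Prop := closure (Set.range ρ.toOp) = Set.univ

namespace QuantumMarkovSemigroup

variable (T : QuantumMarkovSemigroup H)

/-- `ρ` is invariant: `𝒯_{*t}(ρ) = ρ` for all `t ≥ 0`. -/
def IsInvariant (ρ : TraceClass H) : Prop := ∀ t, T.predual t ρ = ρ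

/-- `T` is primitive if it has a unique faithful invariant density. -/
def IsPrimitive : Prop := ∃! ρ : TraceClass H, IsDensity ρ ∧ IsFaithful ρ ∧ T.IsInvariant ρ

/-- The Cesàro mean `t⁻¹ ∫₀ᵗ 𝒯_{*s}(η) ds` (Bochner integral for the trace norm). -/
def cesaroMean (η : TraceClass H) (t : ℝ) : TraceClass H :=
  t⁻¹ • ∫ s in (0 : ℝ)..t, T.predual s.toNNReal η

end QuantumMarkovSemigroup

end QuantumMarkov

end

/-!
A faithful invariant density `ρ` dominates every density `η` up to an arbitrarily small error: for
`ε > 0` there is `c` with `tr (η x) ≤ ε + c tr (ρ x)` for all `0 ≤ x ≤ 1`. Applied to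
`x = T_t (1 - P)`, with `P` a finite rank projection, this bounds the tail of `T_{*t} η` by the tail
of `ρ` uniformly in `t`, so the orbit of `η` is totally bounded in trace norm and its closed convex
hull, which contains the Cesàro means, is compact. Shifting time changes a Cesàro mean only by
`O(1/t)`, so every cluster point `σ` is an invariant density. Then `(ρ + σ) / 2` is a faithful
invariant density, and uniqueness gives `σ = ρ`.
-/

noncomputable section

open scoped ComplexOrder

namespace QuantumMarkov

open InnerProductSpace (rankOne)

variable {H : Type*} [NormedAddCommGroup H] [InnerProductSpace ℂ H] [CompleteSpace H]

section HilbertSchmidt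

lemma sq_tsum_mul_le {ι : Type*} (f g : ι → ℝ≥0∞) :
    (∑' i, f i * g i) ^ 2 ≤ (∑' i, f i ^ 2) * ∑' i, g i ^ 2 := by
  let _ : MeasurableSpace ι := ⊤
  have holder := ENNReal.lintegral_mul_le_Lp_mul_Lq MeasureTheory.Measure.count
    Real.HolderConjugate.two_two (f := f) (g := g) measurable_from_top.aemeasurable
    measurable_from_top.aemeasurable
  simp only [Pi.mul_apply, MeasureTheory.lintegral_count, ENNReal.rpow_two] at holder
  have sq_rpow_half (a : ℝ≥0∞) : (a ^ (1 / 2 : ℝ)) ^ 2 = a := by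
    rw [← ENNReal.rpow_mul_natCast]; norm_num
  calc (∑' i, f i * g i) ^ 2
      ≤ ((∑' i, f i ^ 2) ^ (1 / 2 : ℝ) * (∑' i, g i ^ 2) ^ (1 / 2 : ℝ)) ^ 2 := by gcongr
    _ = (∑' i, f i ^ 2) * ∑' i, g i ^ 2 := by rw [mul_pow, sq_rpow_half, sq_rpow_half]

lemma hsSq_add_le (A B : H →L[ℂ] H) : hsSq (A + B) ≤ 2 * (hsSq A + hsSq B) := by
  simp only [hsSq, ← ENNReal.tsum_add, ← ENNReal.tsum_mul_left]
  refine ENNReal.tsum_le_tsum fun i => ?_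
  calc ‖(A + B) (basis H i)‖ₑ ^ 2
      ≤ (‖A (basis H i)‖ₑ + ‖B (basis H i)‖ₑ) ^ 2 := by gcongr; exact enorm_add_le _ _
    _ ≤ 2 * (‖A (basis H i)‖ₑ ^ 2 + ‖B (basis H i)‖ₑ ^ 2) := by
        simp only [enorm_eq_nnnorm]
        norm_cast
        exact add_sq_le

lemma hsSq_rankOne (u v : H) : hsSq (rankOne ℂ u v) = ‖u‖ₑ ^ 2 * ‖v‖ₑ ^ 2 := by
  rw [hsSq, enorm_sq_eq_tsum v, ← ENNReal.tsum_mul_left]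
  refine tsum_congr fun i => ?_
  rw [InnerProductSpace.rankOne_apply, enorm_smul, mul_pow, mul_comm, ← inner_conj_symm,
    RCLike.enorm_conj]

lemma hsSq_eq_of_star_mul_self_eq {A B : H →L[ℂ] H} (h : star A * A = star B * B) :
    hsSq A = hsSq B := by
  refine tsum_congr fun i => ?_
  have inner_eq : ⟪A (basis H i), A (basis H i)⟫_ℂ = ⟪B (basis H i), B (basis H i)⟫_ℂ := by
    rw [← inner_star_mul, ← inner_star_mul, h]
  rw [inner_self_eq_norm_sq_to_K, inner_self_eq_norm_sq_to_K] at inner_eq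
  rw [← ofReal_norm, ← ofReal_norm, ← ENNReal.ofReal_pow (norm_nonneg _),
    ← ENNReal.ofReal_pow (norm_nonneg _)]
  congr 1
  exact_mod_cast inner_eq

lemma sq_tsum_enorm_inner_mul_le (A B : H →L[ℂ] H) :
    (∑' i, ‖⟪basis H i, (A * B) (basis H i)⟫_ℂ‖ₑ) ^ 2 ≤ hsSq A * hsSq B := by
  calc (∑' i, ‖⟪basis H i, (A * B) (basis H i)⟫_ℂ‖ₑ) ^ 2
      ≤ (∑' i, ‖star A (basis H i)‖ₑ * ‖B (basis H i)‖ₑ) ^ 2 := by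
        gcongr with i
        rw [← star_star A, inner_star_mul, star_star]
        simp only [enorm_eq_nnnorm]
        exact_mod_cast nnnorm_inner_le_nnnorm (𝕜 := ℂ) _ _
    _ ≤ hsSq (star A) * hsSq B := sq_tsum_mul_le _ _
    _ = hsSq A * hsSq B := by rw [hsSq_star]

lemma eTraceNorm_mul_sq_le (A B : H →L[ℂ] H) : eTraceNorm (A * B) ^ 2 ≤ hsSq A * hsSq B := by
  obtain ⟨V, -, hV, -, -, hVs, -, -⟩ := exists_factor (A * B)
  calc eTraceNorm (A * B) ^ 2
      ≤ (∑' i, ‖⟪basis H i, (star V * A * B) (basis H i)⟫_ℂ‖ₑ) ^ 2 := by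
        unfold eTraceNorm
        gcongr with i
        rw [mul_assoc, hVs]
        exact ofReal_re_le_enorm _
    _ ≤ hsSq (star V * A) * hsSq B := sq_tsum_enorm_inner_mul_le _ _
    _ ≤ hsSq A * hsSq B := by
        gcongr
        calc hsSq (star V * A) ≤ ‖star V‖ₑ ^ 2 * hsSq A := hsSq_mul_le _ _
          _ ≤ 1 ^ 2 * hsSq A := by gcongr; rwa [enorm_eq_nnnorm, nnnorm_star]
          _ = hsSq A := by rw [one_pow, one_mul]

lemma isTraceClass_mul {A B : H →L[ℂ] H} (hA : hsSq A ≠ ∞) (hB : hsSq B ≠ ∞) :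
    IsTraceClass (A * B) :=
  isTraceClass_iff.2 fun h => ENNReal.mul_ne_top hA hB <| by
    simpa [h] using eTraceNorm_mul_sq_le A B

lemma tsum_inner_apply_mul_inner_apply (A B : H →L[ℂ] H) (x y : H) :
    ∑' j, ⟪x, A (basis H j)⟫_ℂ * ⟪basis H j, B y⟫_ℂ = ⟪x, (A * B) y⟫_ℂ := by
  simp_rw [← ContinuousLinearMap.adjoint_inner_left A, (basis H).tsum_inner_mul_inner]
  rw [ContinuousLinearMap.adjoint_inner_left]
  rfl

lemma hsSq_eq_tsum_prod (A : H →L[ℂ] H) :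
    hsSq A = ∑' p : basisIndex H × basisIndex H, ‖⟪basis H p.1, A (basis H p.2)⟫_ℂ‖ₑ ^ 2 := by
  rw [ENNReal.tsum_prod', ENNReal.tsum_comm]
  exact tsum_congr fun j => enorm_sq_eq_tsum _

lemma summable_inner_apply_mul_inner_apply {A B : H →L[ℂ] H} (hA : hsSq A ≠ ∞)
    (hB : hsSq B ≠ ∞) : Summable fun p : basisIndex H × basisIndex H =>
      ⟪basis H p.1, A (basis H p.2)⟫_ℂ * ⟪basis H p.2, B (basis H p.1)⟫_ℂ := by
  have cauchySchwarz := sq_tsum_mul_le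
    (fun p : basisIndex H × basisIndex H => ‖⟪basis H p.1, A (basis H p.2)⟫_ℂ‖ₑ)
    fun p => ‖⟪basis H p.2, B (basis H p.1)⟫_ℂ‖ₑ
  rw [← hsSq_eq_tsum_prod, ← (Equiv.prodComm (basisIndex H) (basisIndex H)).tsum_eq
    fun p => ‖⟪basis H p.2, B (basis H p.1)⟫_ℂ‖ₑ ^ 2] at cauchySchwarz
  simp only [Equiv.prodComm_apply, Prod.fst_swap, Prod.snd_swap, ← hsSq_eq_tsum_prod,
    ← enorm_mul] at cauchySchwarz
  have tsum_ne_top := (ENNReal.pow_ne_top_iff.1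
    (ne_top_of_le_ne_top (ENNReal.mul_ne_top hA hB) cauchySchwarz)).resolve_right two_ne_zero
  exact .of_norm (ENNReal.summable_toReal tsum_ne_top)

lemma tsum_inner_mul_comm {A B : H →L[ℂ] H} (hA : hsSq A ≠ ∞) (hB : hsSq B ≠ ∞) :
    ∑' i, ⟪basis H i, (A * B) (basis H i)⟫_ℂ = ∑' i, ⟪basis H i, (B * A) (basis H i)⟫_ℂ := by
  have swap := (summable_inner_apply_mul_inner_apply hA hB).tsum_comm
    (f := fun i j => ⟪basis H i, A (basis H j)⟫_ℂ * ⟪basis H j, B (basis H i)⟫_ℂ)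
  simp_rw [← tsum_inner_apply_mul_inner_apply, ← swap, mul_comm]

end HilbertSchmidt

section TraceDuality

lemma norm_pairing_le (x : H →L[ℂ] H) (σ : TraceClass H) : ‖pairing H x σ‖ ≤ ‖x‖ * ‖σ‖ := by
  obtain ⟨U, C, hU, -, hσ, -, -, hnorm⟩ := exists_factor σ.toOp
  rw [TraceClass.eTraceNorm_toOp] at hnorm
  have sq_le : (∑' i, ‖⟪basis H i, (σ.mulOp x).toOp (basis H i)⟫_ℂ‖ₑ) ^ 2 ≤
      (‖x‖ₑ * ENNReal.ofReal ‖σ‖) ^ 2 :=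
    calc (∑' i, ‖⟪basis H i, (σ.mulOp x).toOp (basis H i)⟫_ℂ‖ₑ) ^ 2
        = (∑' i, ‖⟪basis H i, (U * C * (C * x)) (basis H i)⟫_ℂ‖ₑ) ^ 2 := by
          rw [TraceClass.mulOp, TraceClass.toOp_mk, hσ]; simp only [mul_assoc]
      _ ≤ hsSq (U * C) * hsSq (C * x) := sq_tsum_enorm_inner_mul_le _ _
      _ ≤ 1 ^ 2 * hsSq C * (‖x‖ₑ ^ 2 * hsSq C) := by
          gcongr
          · exact (hsSq_mul_le U C).trans (by gcongr)
          · exact hsSq_mul_le' x C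
      _ = (‖x‖ₑ * ENNReal.ofReal ‖σ‖) ^ 2 := by rw [hnorm]; ring
  have enorm_le : ‖pairing H x σ‖ₑ ≤ ‖x‖ₑ * ENNReal.ofReal ‖σ‖ :=
    enorm_tsum_le_tsum_enorm.trans ((ENNReal.pow_le_pow_left_iff two_ne_zero).1 sq_le)
  rwa [← ofReal_norm, ← ofReal_norm, ← ENNReal.ofReal_mul (norm_nonneg _),
    ENNReal.ofReal_le_ofReal_iff (by positivity)] at enorm_le

/-- The duality `pairing` as a continuous bilinear map: `traceMul x σ = tr (σ x)`. -/
def traceMul : (H →L[ℂ] H) →L[ℂ] TraceClass H →L[ℂ] ℂ :=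
  (pairing H).mkContinuous₂ 1 fun x σ => by simpa using norm_pairing_le x σ

lemma traceMul_apply (x : H →L[ℂ] H) (σ : TraceClass H) :
    traceMul x σ = ∑' i, ⟪basis H i, (σ.toOp * x) (basis H i)⟫_ℂ :=
  rfl

lemma traceMul_one (σ : TraceClass H) : traceMul 1 σ = σ.trace := by
  rw [traceMul_apply, mul_one]; rfl

lemma traceMul_rankOne (u v : H) (σ : TraceClass H) :
    traceMul (rankOne ℂ u v) σ = ⟪v, σ.toOp u⟫_ℂ := by
  rw [traceMul_apply, ← (basis H).tsum_inner_mul_inner v (σ.toOp u)]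
  refine tsum_congr fun i => ?_
  rw [mul_apply_eq_comp, InnerProductSpace.rankOne_apply, map_smul, inner_smul_right]

lemma ext_traceMul {σ τ : TraceClass H} (h : ∀ x, traceMul x σ = traceMul x τ) : σ = τ :=
  eq_of_trace_mulOp_eq h

end TraceDuality

section PositiveTraceClass

variable {σ : TraceClass H}

lemma hsSq_sqrt (hσ : 0 ≤ σ.toOp) : hsSq (CFC.sqrt σ.toOp) = ENNReal.ofReal ‖σ‖ := by
  obtain ⟨-, C, -, hC, -, -, hCC, hnorm⟩ := exists_factor σ.toOp
  rw [← σ.eTraceNorm_toOp, hnorm]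
  refine hsSq_eq_of_star_mul_self_eq ?_
  rw [hC, ← hCC, CFC.abs_of_nonneg _ hσ, (CFC.sqrt_nonneg _).isSelfAdjoint.star_eq,
    CFC.sqrt_mul_sqrt_self _ hσ]

lemma hsSq_sqrt_ne_top (hσ : 0 ≤ σ.toOp) : hsSq (CFC.sqrt σ.toOp) ≠ ∞ :=
  hsSq_sqrt hσ ▸ ENNReal.ofReal_ne_top

lemma hsSq_mul_sqrt_ne_top (hσ : 0 ≤ σ.toOp) (S : H →L[ℂ] H) :
    hsSq (S * CFC.sqrt σ.toOp) ≠ ∞ :=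
  ne_top_of_le_ne_top (ENNReal.mul_ne_top (by finiteness) (hsSq_sqrt_ne_top hσ)) (hsSq_mul_le _ _)

lemma traceMul_star_mul_self (hσ : 0 ≤ σ.toOp) (S : H →L[ℂ] H) :
    traceMul (star S * S) σ = ((hsSq (S * CFC.sqrt σ.toOp)).toReal : ℂ) := by
  set R := CFC.sqrt σ.toOp
  have hRR : R * R = σ.toOp := CFC.sqrt_mul_sqrt_self _ hσ
  have star_mul_R : star (S * R) = R * star S := by
    rw [star_mul, (CFC.sqrt_nonneg _).isSelfAdjoint.star_eq]
  have hSR := hsSq_mul_sqrt_ne_top hσ S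
  calc traceMul (star S * S) σ
      = ∑' i, ⟪basis H i, (R * (star (S * R) * S)) (basis H i)⟫_ℂ := by
        rw [traceMul_apply, star_mul_R, ← hRR]; simp only [mul_assoc]
    _ = ∑' i, ⟪basis H i, (star (S * R) * S * R) (basis H i)⟫_ℂ := by
        refine tsum_inner_mul_comm (hsSq_sqrt_ne_top hσ) (ne_top_of_le_ne_top ?_
          (hsSq_mul_le' _ _))
        exact ENNReal.mul_ne_top (by finiteness) (hsSq_star (S * R) ▸ hSR)
    _ = ∑' i, ((‖(S * R) (basis H i)‖ₑ ^ 2).toReal : ℂ) := by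
        refine tsum_congr fun i => ?_
        rw [mul_assoc, inner_star_mul, inner_self_eq_norm_sq_to_K, ENNReal.toReal_pow, toReal_enorm]
        norm_cast
    _ = ((hsSq (S * R)).toReal : ℂ) := by
        rw [hsSq, ENNReal.tsum_toReal_eq (fun i => by finiteness), Complex.ofReal_tsum]

lemma trace_eq_norm (hσ : 0 ≤ σ.toOp) : σ.trace = (‖σ‖ : ℂ) := by
  have h := traceMul_star_mul_self hσ 1
  rwa [star_one, mul_one, one_mul, traceMul_one, hsSq_sqrt hσ,
    ENNReal.toReal_ofReal (norm_nonneg σ)] at h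

lemma traceMul_nonneg (hσ : 0 ≤ σ.toOp) {x : H →L[ℂ] H} (hx : 0 ≤ x) : 0 ≤ traceMul x σ := by
  rw [← CFC.sqrt_mul_sqrt_self x hx]
  nth_rw 1 [← (CFC.sqrt_nonneg x).isSelfAdjoint.star_eq]
  rw [traceMul_star_mul_self hσ]
  exact_mod_cast ENNReal.toReal_nonneg

lemma toOp_nonneg_iff : 0 ≤ σ.toOp ↔ ∀ x, 0 ≤ x → 0 ≤ traceMul x σ := by
  refine ⟨fun hσ x => traceMul_nonneg hσ, fun h => ?_⟩
  rw [ContinuousLinearMap.nonneg_iff_isPositive, ContinuousLinearMap.isPositive_iff_complex]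
  intro u
  have rankOne_nonneg := (ContinuousLinearMap.nonneg_iff_isPositive _).2
    (InnerProductSpace.isPositive_rankOne_self (𝕜 := ℂ) u)
  have inner_nonneg := traceMul_rankOne u u σ ▸ h _ rankOne_nonneg
  obtain ⟨re_nonneg, im_eq⟩ := Complex.nonneg_iff.1 inner_nonneg
  have inner_comm : ⟪σ.toOp u, u⟫_ℂ = ⟪u, σ.toOp u⟫_ℂ := by
    rw [← inner_conj_symm, Complex.conj_eq_iff_im.2 im_eq.symm]
  rw [inner_comm]
  exact ⟨Complex.ext rfl im_eq, re_nonneg⟩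

end PositiveTraceClass

section Truncation

/-- The orthogonal projection onto the span of the basis vectors indexed by `F`. -/
def basisProj (F : Finset (basisIndex H)) : H →L[ℂ] H :=
  ∑ i ∈ F, rankOne ℂ (basis H i) (basis H i)

lemma isStarProjection_basisProj (F : Finset (basisIndex H)) :
    IsStarProjection (basisProj F) where
  isSelfAdjoint := by
    simp only [basisProj, IsSelfAdjoint, star_sum, ContinuousLinearMap.star_eq_adjoint,
      InnerProductSpace.adjoint_rankOne]
  isIdempotentElem := by
    simp only [basisProj, IsIdempotentElem, Finset.sum_mul_sum]
    classical
    refine Finset.sum_congr rfl fun i hi => ?_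
    simp only [ContinuousLinearMap.mul_def, InnerProductSpace.rankOne_comp_rankOne,
      orthonormal_iff_ite.1 (basis H).orthonormal, ite_smul, one_smul, zero_smul,
      Finset.sum_ite_eq, hi, if_true]

/-- The matrix unit `|eᵢ⟩⟨eⱼ|`. -/
def matrixUnit (i j : basisIndex H) : TraceClass H :=
  .mk (rankOne ℂ (basis H i) (basis H j)) <| by
    have hsSq_ne_top (k : basisIndex H) : hsSq (rankOne ℂ (basis H i) (basis H k)) ≠ ∞ := by
      rw [hsSq_rankOne]; finiteness
    have h := isTraceClass_mul (hsSq_ne_top i) (hsSq_ne_top j)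
    rwa [ContinuousLinearMap.mul_def, InnerProductSpace.rankOne_comp_rankOne,
      inner_self_eq_norm_sq_to_K, (basis H).orthonormal.1, RCLike.ofReal_one, one_pow,
      one_smul] at h

/-- The compression `σ ↦ P σ P` by `P = basisProj F`, written out in matrix units. -/
def truncate (F : Finset (basisIndex H)) : TraceClass H →L[ℂ] TraceClass H :=
  ∑ i ∈ F, ∑ j ∈ F, (traceMul (rankOne ℂ (basis H j) (basis H i))).smulRight (matrixUnit i j)

lemma truncate_apply (F : Finset (basisIndex H)) (σ : TraceClass H) :
    truncate F σ =
      ∑ i ∈ F, ∑ j ∈ F, ⟪basis H i, σ.toOp (basis H j)⟫_ℂ • matrixUnit i j := by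
  simp only [truncate, sum_apply, ContinuousLinearMap.smulRight_apply, traceMul_rankOne]

lemma toOp_truncate (F : Finset (basisIndex H)) (σ : TraceClass H) :
    (truncate F σ).toOp = basisProj F * σ.toOp * basisProj F := by
  simp only [truncate_apply, map_sum, map_smul, basisProj, Finset.sum_mul, Finset.mul_sum]
  rw [Finset.sum_comm]
  refine Finset.sum_congr rfl fun i _ => Finset.sum_congr rfl fun j _ => ?_
  ext x
  simp [matrixUnit, smul_smul, mul_comm]

lemma isCompactOperator_truncate (F : Finset (basisIndex H)) :
    IsCompactOperator (truncate F) := by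
  have smulRight_mem (i j : basisIndex H) :
      (traceMul (rankOne ℂ (basis H j) (basis H i))).smulRight (matrixUnit i j) ∈
        compactOperator (.id ℂ) (TraceClass H) (TraceClass H) :=
    have span_isCompact : IsCompactOperator (ContinuousLinearMap.toSpanSingleton ℂ
        (matrixUnit i j)) := isCompactOperator_of_locallyCompactSpace_rng _
    span_isCompact.comp_clm (traceMul (rankOne ℂ (basis H j) (basis H i)))
  exact sum_mem (S := compactOperator (.id ℂ) (TraceClass H) (TraceClass H)) fun i _ =>
    sum_mem fun j _ => smulRight_mem i j

lemma tendsto_traceMul_one_sub_basisProj (σ : TraceClass H) :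
    Filter.Tendsto (fun F => traceMul (1 - basisProj F) σ) Filter.atTop (nhds 0) := by
  have trace_eq_tsum : traceMul 1 σ = ∑' i, ⟪basis H i, σ.toOp (basis H i)⟫_ℂ := by
    rw [traceMul_apply, mul_one]
  have h := σ.isTraceClass.summable_inner.hasSum.const_sub (traceMul 1 σ)
  rw [← trace_eq_tsum, sub_self] at h
  refine h.congr fun F => ?_
  simp only [map_sub, sub_apply, basisProj, map_sum, sum_apply, traceMul_rankOne]

lemma hsSq_mul_sqrt_of_isStarProjection {σ : TraceClass H} (hσ : 0 ≤ σ.toOp) {P : H →L[ℂ] H}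
    (hP : IsStarProjection P) :
    hsSq (P * CFC.sqrt σ.toOp) = ENNReal.ofReal (traceMul P σ).re := by
  have h := traceMul_star_mul_self hσ P
  rw [hP.isSelfAdjoint.star_eq, hP.isIdempotentElem.eq] at h
  rw [h, Complex.ofReal_re, ENNReal.ofReal_toReal (hsSq_mul_sqrt_ne_top hσ P)]

lemma eTraceNorm_mul_le_of_hsSq_le {A B : H →L[ℂ] H} {a b : ℝ} (ha : 0 ≤ a)
    (hA : hsSq A ≤ ENNReal.ofReal a) (hB : hsSq B ≤ ENNReal.ofReal b) :
    eTraceNorm (A * B) ≤ ENNReal.ofReal √(a * b) := by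
  refine (ENNReal.pow_le_pow_left_iff two_ne_zero).1 ?_
  calc eTraceNorm (A * B) ^ 2 ≤ hsSq A * hsSq B := eTraceNorm_mul_sq_le A B
    _ ≤ ENNReal.ofReal a * ENNReal.ofReal b := by gcongr
    _ = ENNReal.ofReal (a * b) := (ENNReal.ofReal_mul ha).symm
    _ ≤ ENNReal.ofReal √(a * b) ^ 2 := by
        rw [← ENNReal.ofReal_pow (Real.sqrt_nonneg _), Real.sq_sqrt']
        exact ENNReal.ofReal_le_ofReal (le_max_left _ _)

lemma eTraceNorm_sub_compress_le {σ : TraceClass H} (hσ : 0 ≤ σ.toOp) {P : H →L[ℂ] H}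
    (hP : IsStarProjection P) :
    eTraceNorm (σ.toOp - P * σ.toOp * P) ≤
      ENNReal.ofReal (2 * √(‖σ‖ * (traceMul (1 - P) σ).re)) := by
  set C := CFC.sqrt σ.toOp with hC
  set tail := (traceMul (1 - P) σ).re
  have star_C : star C = C := (CFC.sqrt_nonneg _).isSelfAdjoint.star_eq
  have hsSq_C : hsSq C = ENNReal.ofReal ‖σ‖ := hsSq_sqrt hσ
  have hsSq_QC : hsSq ((1 - P) * C) = ENNReal.ofReal tail :=
    hsSq_mul_sqrt_of_isStarProjection hσ hP.one_sub
  have hsSq_CQ : hsSq (C * (1 - P)) = ENNReal.ofReal tail := by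
    rw [← hsSq_QC, ← hsSq_star, star_mul, star_C, hP.one_sub.isSelfAdjoint.star_eq]
  have hsSq_CP : hsSq (C * P) ≤ ENNReal.ofReal ‖σ‖ := by
    have enorm_P : ‖P‖ₑ ≤ 1 := by
      rw [← ofReal_norm, ENNReal.ofReal_le_one]
      exact hP.norm_le
    calc hsSq (C * P) ≤ ‖P‖ₑ ^ 2 * hsSq C := hsSq_mul_le' P C
      _ ≤ 1 ^ 2 * hsSq C := by gcongr
      _ = ENNReal.ofReal ‖σ‖ := by rw [one_pow, one_mul, hsSq_C]
  have decomposition : σ.toOp - P * σ.toOp * P = C * (C * (1 - P)) + (1 - P) * C * (C * P) := by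
    rw [← CFC.sqrt_mul_sqrt_self σ.toOp hσ, ← hC]
    noncomm_ring
  calc eTraceNorm (σ.toOp - P * σ.toOp * P)
      ≤ eTraceNorm (C * (C * (1 - P))) + eTraceNorm ((1 - P) * C * (C * P)) :=
        decomposition ▸ eTraceNorm_add_le _ _
    _ ≤ ENNReal.ofReal √(‖σ‖ * tail) + ENNReal.ofReal √(‖σ‖ * tail) := by
        gcongr
        · exact eTraceNorm_mul_le_of_hsSq_le (norm_nonneg σ) hsSq_C.le hsSq_CQ.le
        · have tail_nonneg : 0 ≤ tail :=
            (Complex.nonneg_iff.1 (traceMul_nonneg hσ hP.one_sub_nonneg)).1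
          rw [mul_comm ‖σ‖]
          exact eTraceNorm_mul_le_of_hsSq_le tail_nonneg hsSq_QC.le hsSq_CP
    _ = ENNReal.ofReal (2 * √(‖σ‖ * tail)) := by
        rw [← ENNReal.ofReal_add (by positivity) (by positivity), two_mul]

lemma norm_sub_truncate_le {σ : TraceClass H} (hσ : 0 ≤ σ.toOp) (F : Finset (basisIndex H)) :
    ‖σ - truncate F σ‖ ≤ 2 * √(‖σ‖ * (traceMul (1 - basisProj F) σ).re) := by
  have h := eTraceNorm_sub_compress_le hσ (isStarProjection_basisProj F)
  rwa [← toOp_truncate, ← map_sub, TraceClass.eTraceNorm_toOp,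
    ENNReal.ofReal_le_ofReal_iff (by positivity)] at h

lemma dist_le_dist_truncate_add {σ τ : TraceClass H} (hσ : 0 ≤ σ.toOp) (hτ : 0 ≤ τ.toOp)
    (F : Finset (basisIndex H)) :
    dist σ τ ≤ 2 * √(‖σ‖ * (traceMul (1 - basisProj F) σ).re) +
      dist (truncate F σ) (truncate F τ) + 2 * √(‖τ‖ * (traceMul (1 - basisProj F) τ).re) := by
  refine (dist_triangle4 σ (truncate F σ) (truncate F τ) τ).trans ?_
  rw [dist_eq_norm σ, dist_comm _ τ, dist_eq_norm τ]
  gcongr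
  · exact norm_sub_truncate_le hσ F
  · exact norm_sub_truncate_le hτ F

lemma tendsto_of_tendsto_inner {ι : Type*} {l : Filter ι} {u : ι → TraceClass H}
    {σ : TraceClass H} (hu : ∀ n, 0 ≤ (u n).toOp) (hσ : 0 ≤ σ.toOp)
    (inner_tendsto : ∀ v w,
      Filter.Tendsto (fun n => ⟪v, (u n).toOp w⟫_ℂ) l (nhds ⟪v, σ.toOp w⟫_ℂ))
    (trace_tendsto : Filter.Tendsto (fun n => (u n).trace) l (nhds σ.trace)) :
    Filter.Tendsto u l (nhds σ) := by
  have truncate_tendsto (F) : Filter.Tendsto (fun n => truncate F (u n)) l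
      (nhds (truncate F σ)) := by
    simp only [truncate_apply]
    exact tendsto_finsetSum _ fun i _ => tendsto_finsetSum _ fun j _ =>
      (inner_tendsto _ _).smul_const _
  have tail_tendsto (F) : Filter.Tendsto (fun n => traceMul (1 - basisProj F) (u n)) l
      (nhds (traceMul (1 - basisProj F) σ)) := by
    simp only [map_sub, sub_apply, basisProj, map_sum, sum_apply, traceMul_rankOne, traceMul_one]
    exact trace_tendsto.sub (tendsto_finsetSum _ fun i _ => inner_tendsto _ _)
  have norm_tendsto : Filter.Tendsto (fun n => ‖u n‖) l (nhds ‖σ‖) := by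
    have h := (Complex.continuous_re.tendsto _).comp trace_tendsto
    simpa only [Function.comp_def, trace_eq_norm (hu _), trace_eq_norm hσ, Complex.ofReal_re]
      using h
  let err (F : Finset (basisIndex H)) (τ : TraceClass H) : ℝ :=
    2 * √(‖τ‖ * (traceMul (1 - basisProj F) τ).re)
  have bound_tendsto (F) : Filter.Tendsto
      (fun n => err F (u n) + dist (truncate F (u n)) (truncate F σ) + err F σ) l
      (nhds (2 * err F σ)) := by
    have err_tendsto : Filter.Tendsto (fun n => err F (u n)) l (nhds (err F σ)) :=
      ((norm_tendsto.mul
        ((Complex.continuous_re.tendsto _).comp (tail_tendsto F))).sqrt).const_mul 2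
    have dist_tendsto := (truncate_tendsto F).dist (tendsto_const_nhds (x := truncate F σ))
    simpa [two_mul] using (err_tendsto.add dist_tendsto).add_const (err F σ)
  have err_zero : Filter.Tendsto (fun F => 2 * err F σ) Filter.atTop (nhds 0) := by
    have h := (Complex.continuous_re.tendsto _).comp (tendsto_traceMul_one_sub_basisProj σ)
    simpa [err] using (((h.const_mul ‖σ‖).sqrt).const_mul 2).const_mul 2
  refine Metric.tendsto_nhds.2 fun ε hε => ?_
  obtain ⟨F, hF⟩ := (err_zero.eventually_lt_const hε).exists
  exact ((bound_tendsto F).eventually_lt_const hF).mono fun n =>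
    (dist_le_dist_truncate_add (hu n) hσ F).trans_lt

end Truncation

section Tightness

/-- Tightness of a set of positive trace class operators: uniformly on `S`, all but `ε` of the
trace is carried by finitely many basis vectors. -/
def IsTight (S : Set (TraceClass H)) : Prop :=
  ∀ ε > 0, ∃ F : Finset (basisIndex H), ∀ σ ∈ S, (traceMul (1 - basisProj F) σ).re ≤ ε

lemma totallyBounded_of_forall_exists_dist_le {X : Type*} [PseudoMetricSpace X] {S : Set X}
    (h : ∀ ε > 0, ∃ f : X → X, TotallyBounded (f '' S) ∧ ∀ x ∈ S, dist x (f x) ≤ ε) :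
    TotallyBounded S := by
  refine Metric.totallyBounded_iff.2 fun ε hε => ?_
  obtain ⟨f, image_totallyBounded, dist_le⟩ := h (ε / 2) (half_pos hε)
  obtain ⟨t, t_finite, image_subset⟩ :=
    Metric.totallyBounded_iff.1 image_totallyBounded (ε / 2) (half_pos hε)
  refine ⟨t, t_finite, fun x hx => ?_⟩
  obtain ⟨y, hy, dist_lt⟩ := Set.mem_iUnion₂.1 (image_subset (Set.mem_image_of_mem f hx))
  refine Set.mem_iUnion₂.2 ⟨y, hy, ?_⟩
  calc dist x y ≤ dist x (f x) + dist (f x) y := dist_triangle _ _ _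
    _ < ε / 2 + ε / 2 := add_lt_add_of_le_of_lt (dist_le x hx) dist_lt
    _ = ε := add_halves ε

lemma totallyBounded_of_isTight {S : Set (TraceClass H)} (hS : ∀ σ ∈ S, 0 ≤ σ.toOp)
    (bounded : Bornology.IsBounded S) (tight : IsTight S) : TotallyBounded S := by
  obtain ⟨M, M_pos, norm_le⟩ := bounded.exists_pos_norm_le
  refine totallyBounded_of_forall_exists_dist_le fun ε hε => ?_
  obtain ⟨F, tail_le⟩ := tight ((ε / 2) ^ 2 / M) (by positivity)
  refine ⟨truncate F, ?_, fun σ hσ => ?_⟩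
  · exact ((isCompactOperator_truncate F).isCompact_closure_image_of_bounded
      bounded).totallyBounded.subset subset_closure
  · calc dist σ (truncate F σ) ≤ 2 * √(‖σ‖ * (traceMul (1 - basisProj F) σ).re) :=
          (dist_eq_norm _ _).trans_le (norm_sub_truncate_le (hS σ hσ) F)
      _ ≤ 2 * √(M * ((ε / 2) ^ 2 / M)) := by
          gcongr
          · exact (Complex.nonneg_iff.1 (traceMul_nonneg (hS σ hσ)
              (isStarProjection_basisProj F).one_sub_nonneg)).1
          · exact norm_le σ hσ
          · exact tail_le σ hσ
      _ = ε := by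
          rw [mul_div_cancel₀ _ M_pos.ne', Real.sqrt_sq (by positivity),
            mul_div_cancel₀ _ two_ne_zero]

end Tightness

section AbsoluteContinuity

lemma exists_hsSq_sub_mul_le {R C : H →L[ℂ] H} (hR : DenseRange R) (hC : hsSq C ≠ ∞) {δ : ℝ≥0∞}
    (hδ : 0 < δ) : ∃ B : H →L[ℂ] H, hsSq (C - R * B) ≤ δ := by
  obtain ⟨F, tail_le⟩ := ((ENNReal.tendsto_tsum_compl_atTop_zero hC).eventually_le_const
    (ENNReal.half_pos hδ.ne')).exists
  have exists_approx (i : basisIndex H) :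
      ∃ w, ‖C (basis H i) - R w‖ₑ ^ 2 ≤ δ / 2 / F.card := by
    have share_pos : 0 < δ / 2 / F.card :=
      ENNReal.div_pos (ENNReal.half_pos hδ.ne').ne' (ENNReal.natCast_ne_top _)
    have isOpen_near : IsOpen {y | ‖C (basis H i) - y‖ₑ ^ 2 < δ / 2 / F.card} :=
      isOpen_lt (by fun_prop) continuous_const
    obtain ⟨w, hw⟩ := hR.exists_mem_open isOpen_near ⟨C (basis H i), by simpa using share_pos⟩
    exact ⟨w, hw.le⟩
  choose w hw using exists_approx
  classical
  refine ⟨∑ i ∈ F, rankOne ℂ (w i) (basis H i), ?_⟩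
  set B := ∑ i ∈ F, rankOne ℂ (w i) (basis H i)
  have B_apply (j : basisIndex H) : B (basis H j) = if j ∈ F then w j else 0 := by
    simp [B, orthonormal_iff_ite.1 (basis H).orthonormal]
  calc hsSq (C - R * B)
      = ∑ i ∈ F, ‖(C - R * B) (basis H i)‖ₑ ^ 2 +
          ∑' i : {i // i ∉ F}, ‖(C - R * B) (basis H i)‖ₑ ^ 2 :=
        (ENNReal.sum_add_tsum_compl F _).symm
    _ ≤ ∑ i ∈ F, δ / 2 / F.card + δ / 2 := by
        gcongr with i hi
        · simpa [B_apply, hi] using hw i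
        · refine (ENNReal.tsum_le_tsum fun i => ?_).trans tail_le
          simp [B_apply, i.2]
    _ ≤ δ / 2 + δ / 2 := by
        rw [Finset.sum_const, nsmul_eq_mul]
        gcongr
        exact ENNReal.mul_div_le
    _ = δ := ENNReal.add_halves δ

lemma exists_hsSq_mul_le {R C : H →L[ℂ] H} (hR : DenseRange R) (hC : hsSq C ≠ ∞) {ε : ℝ≥0∞}
    (hε : 0 < ε) :
    ∃ K ≠ ∞, ∀ S : H →L[ℂ] H, ‖S‖ₑ ≤ 1 → hsSq (S * C) ≤ ε + K * hsSq (S * R) := by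
  obtain ⟨B, hB⟩ := exists_hsSq_sub_mul_le hR hC (ENNReal.half_pos hε.ne')
  refine ⟨2 * ‖B‖ₑ ^ 2, by finiteness, fun S hS => ?_⟩
  calc hsSq (S * C) = hsSq (S * (C - R * B) + S * R * B) := by congr 1; noncomm_ring
    _ ≤ 2 * (hsSq (S * (C - R * B)) + hsSq (S * R * B)) := hsSq_add_le _ _
    _ ≤ 2 * (1 ^ 2 * (ε / 2) + ‖B‖ₑ ^ 2 * hsSq (S * R)) := by
        gcongr
        · exact (hsSq_mul_le _ _).trans (by gcongr)
        · exact hsSq_mul_le' _ _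
    _ = ε + 2 * ‖B‖ₑ ^ 2 * hsSq (S * R) := by
        rw [one_pow, one_mul, mul_add, ENNReal.mul_div_cancel two_ne_zero ENNReal.ofNat_ne_top,
          mul_assoc]

lemma denseRange_sqrt {ρ : TraceClass H} (hρ : 0 ≤ ρ.toOp) (faithful : IsFaithful ρ) :
    DenseRange ⇑(CFC.sqrt ρ.toOp) := by
  have range_subset : Set.range ρ.toOp ⊆ Set.range ⇑(CFC.sqrt ρ.toOp) := by
    rintro _ ⟨v, rfl⟩
    exact ⟨CFC.sqrt ρ.toOp v,
      congrArg (fun A : H →L[ℂ] H => A v) (CFC.sqrt_mul_sqrt_self ρ.toOp hρ)⟩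
  exact Dense.mono range_subset (dense_iff_closure_eq.2 faithful)

lemma exists_re_traceMul_le {ρ η : TraceClass H} (hρ : 0 ≤ ρ.toOp) (faithful : IsFaithful ρ)
    (hη : 0 ≤ η.toOp) {ε : ℝ} (hε : 0 < ε) :
    ∃ c : ℝ, ∀ x : H →L[ℂ] H, 0 ≤ x → x ≤ 1 →
      (traceMul x η).re ≤ ε + c * (traceMul x ρ).re := by
  obtain ⟨K, hK, hsSq_le⟩ := exists_hsSq_mul_le (denseRange_sqrt hρ faithful)
    (hsSq_sqrt_ne_top hη) (ENNReal.ofReal_pos.2 hε)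
  refine ⟨K.toReal, fun x hx hx_one => ?_⟩
  set S := CFC.sqrt x with S_def
  have star_mul_S : star S * S = x := by
    rw [(CFC.sqrt_nonneg x).isSelfAdjoint.star_eq, CFC.sqrt_mul_sqrt_self x hx]
  have enorm_S : ‖S‖ₑ ≤ 1 := by
    rw [← ofReal_norm, ENNReal.ofReal_le_one, S_def, CFC.norm_sqrt x hx, Real.sqrt_le_one]
    exact (CStarAlgebra.norm_le_one_iff_of_nonneg x hx).2 hx_one
  rw [← star_mul_S, traceMul_star_mul_self hη, traceMul_star_mul_self hρ, Complex.ofReal_re,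
    Complex.ofReal_re]
  have hSR := hsSq_mul_sqrt_ne_top hρ S
  calc (hsSq (S * CFC.sqrt η.toOp)).toReal
      ≤ (ENNReal.ofReal ε + K * hsSq (S * CFC.sqrt ρ.toOp)).toReal :=
        ENNReal.toReal_mono (by finiteness) (hsSq_le S enorm_S)
    _ = ε + K.toReal * (hsSq (S * CFC.sqrt ρ.toOp)).toReal := by
        rw [ENNReal.toReal_add (by finiteness) (by finiteness), ENNReal.toReal_mul,
          ENNReal.toReal_ofReal hε.le]

end AbsoluteContinuity

section Density

lemma inner_apply_eq_zero_iff {A : H →L[ℂ] H} (hA : 0 ≤ A) (v : H) :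
    ⟪v, A v⟫_ℂ = 0 ↔ A v = 0 := by
  have apply_eq : A v = CFC.sqrt A (CFC.sqrt A v) := by
    rw [← mul_apply_eq_comp, CFC.sqrt_mul_sqrt_self A hA]
  refine ⟨fun h => ?_, fun h => by rw [h, inner_zero_right]⟩
  rw [apply_eq, ← mul_apply_eq_comp] at h
  nth_rw 1 [← (CFC.sqrt_nonneg A).isSelfAdjoint.star_eq] at h
  rw [inner_star_mul, inner_self_eq_zero] at h
  rw [apply_eq, h, map_zero]

lemma isFaithful_iff_inner_eq_zero_imp {σ : TraceClass H} (hσ : 0 ≤ σ.toOp) :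
    IsFaithful σ ↔ ∀ v, ⟪v, σ.toOp v⟫_ℂ = 0 → v = 0 := by
  have isSymmetric := ((ContinuousLinearMap.nonneg_iff_isPositive _).1 hσ).isSymmetric
  calc IsFaithful σ ↔ σ.toOp.range.topologicalClosure = ⊤ := by
        rw [← SetLike.coe_set_eq]; rfl
    _ ↔ σ.toOp.ker = ⊥ := by
        rw [Submodule.topologicalClosure_eq_top_iff, isSymmetric.orthogonal_range]
    _ ↔ _ := by
        rw [LinearMap.ker_eq_bot']
        simp only [inner_apply_eq_zero_iff hσ, ContinuousLinearMap.coe_coe]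

lemma IsFaithful.of_smul_le {σ τ : TraceClass H} (faithful : IsFaithful σ) (hσ : 0 ≤ σ.toOp)
    {c : ℝ} (hc : 0 < c) (smul_le : c • σ.toOp ≤ τ.toOp) : IsFaithful τ := by
  have hτ : 0 ≤ τ.toOp := (smul_nonneg hc.le hσ).trans smul_le
  rw [isFaithful_iff_inner_eq_zero_imp hσ] at faithful
  refine (isFaithful_iff_inner_eq_zero_imp hτ).2 fun v hv => faithful v ?_
  have inner_nonneg : 0 ≤ ⟪v, σ.toOp v⟫_ℂ :=
    ((ContinuousLinearMap.nonneg_iff_isPositive _).1 hσ).inner_nonneg_right v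
  have smul_inner_le : c • ⟪v, σ.toOp v⟫_ℂ ≤ 0 := by
    have h := ((ContinuousLinearMap.le_def _ _).1 smul_le).inner_nonneg_right v
    rwa [sub_apply, smul_apply, inner_sub_right, hv, zero_sub, neg_nonneg,
      inner_smul_right_eq_smul] at h
  exact (smul_eq_zero_iff_right hc.ne').1 (smul_inner_le.antisymm (smul_nonneg hc.le inner_nonneg))

lemma IsDensity.norm_eq_one {σ : TraceClass H} (hσ : IsDensity σ) : ‖σ‖ = 1 := by
  exact_mod_cast (trace_eq_norm hσ.nonneg).symm.trans hσ.trace_eq_one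

lemma convex_setOf_isDensity : Convex ℝ {σ : TraceClass H | IsDensity σ} := by
  refine fun σ hσ τ hτ a b ha hb hab => ⟨?_, ?_⟩
  · rw [map_add, LinearMap.map_smul_of_tower, LinearMap.map_smul_of_tower]
    exact add_nonneg (smul_nonneg ha hσ.nonneg) (smul_nonneg hb hτ.nonneg)
  · rw [map_add, LinearMap.map_smul_of_tower, LinearMap.map_smul_of_tower, hσ.trace_eq_one,
      hτ.trace_eq_one, ← add_smul, hab, one_smul]

lemma isClosed_setOf_isDensity : IsClosed {σ : TraceClass H | IsDensity σ} := by
  have setOf_eq : {σ : TraceClass H | IsDensity σ} =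
      {σ | ∀ x, 0 ≤ x → 0 ≤ traceMul x σ} ∩ {σ | traceMul 1 σ = 1} := by
    ext σ
    simp only [Set.mem_inter_iff, Set.mem_ofPred_eq, ← toOp_nonneg_iff, traceMul_one]
    exact ⟨fun h => ⟨h.nonneg, h.trace_eq_one⟩, fun h => ⟨h.1, h.2⟩⟩
  rw [setOf_eq]
  refine .inter ?_ (isClosed_eq (by fun_prop) continuous_const)
  simp only [Set.ofPred_forall]
  exact isClosed_iInter fun x => isClosed_iInter fun _ => isClosed_le continuous_const (by fun_prop)

end Density

lemma tendsto_inv_smul_integral_comp_add_sub {E : Type*} [NormedAddCommGroup E] [NormedSpace ℝ E]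
    {f : ℝ → E} (hf : Continuous f) {C : ℝ} (norm_le : ∀ s, ‖f s‖ ≤ C) (r : ℝ) :
    Filter.Tendsto
      (fun t : ℝ => t⁻¹ • ((∫ s in (0 : ℝ)..t, f (s + r)) - ∫ s in (0 : ℝ)..t, f s))
      Filter.atTop (nhds 0) := by
  have norm_integral_sub_le (t : ℝ) :
      ‖(∫ s in (0 : ℝ)..t, f (s + r)) - ∫ s in (0 : ℝ)..t, f s‖ ≤ C * |r| + C * |r| := by
    rw [intervalIntegral.integral_comp_add_right, zero_add,
      intervalIntegral.integral_interval_sub_interval_comm (hf.intervalIntegrable _ _)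
        (hf.intervalIntegrable _ _) (hf.intervalIntegrable _ _)]
    refine (norm_sub_le _ _).trans (add_le_add ?_ ?_) <;>
      refine (intervalIntegral.norm_integral_le_of_norm_le_const fun s _ => norm_le s).trans_eq ?_
    · rw [zero_sub, abs_neg]
    · rw [sub_add_cancel_left, abs_neg]
  have bounded := Filter.isBoundedUnder_of ⟨_, norm_integral_sub_le⟩ (f := Filter.atTop)
  exact tendsto_inv_atTop_zero.zero_smul_isBoundedUnder_le bounded

namespace QuantumMarkovSemigroup

variable (T : QuantumMarkovSemigroup H) {ρ σ η : TraceClass H}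

lemma traceMul_predual (t : ℝ≥0) (η : TraceClass H) (x : H →L[ℂ] H) :
    traceMul x (T.predual t η) = traceMul (T.map t x) η :=
  T.trace_predual_mulOp t η x

lemma predual_add (t : ℝ≥0) (σ τ : TraceClass H) :
    T.predual t (σ + τ) = T.predual t σ + T.predual t τ :=
  ext_traceMul fun x => by simp only [_root_.map_add, traceMul_predual]

lemma predual_smul (t : ℝ≥0) (c : ℝ) (σ : TraceClass H) :
    T.predual t (c • σ) = c • T.predual t σ :=
  ext_traceMul fun x => by simp only [ContinuousLinearMap.map_smul_of_tower, traceMul_predual]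

lemma isDensity_predual (hη : IsDensity η) (t : ℝ≥0) : IsDensity (T.predual t η) where
  nonneg := toOp_nonneg_iff.2 fun x hx =>
    T.traceMul_predual t η x ▸ traceMul_nonneg hη.nonneg (map_nonneg (T.map t) hx)
  trace_eq_one := by
    rw [← traceMul_one, traceMul_predual, T.map_one, traceMul_one, hη.trace_eq_one]

lemma continuous_traceMul_predual (η : TraceClass H) (x : H →L[ℂ] H) :
    Continuous fun t => traceMul x (T.predual t η) := by
  simp only [traceMul_predual]
  exact (WeakBilin.eval_continuous (pairing H) η).comp (T.weakStar_continuous x)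

lemma continuous_predual (hη : IsDensity η) : Continuous fun t => T.predual t η := by
  refine continuous_iff_continuousAt.2 fun t => ?_
  refine tendsto_of_tendsto_inner (fun s => (T.isDensity_predual hη s).nonneg)
    (T.isDensity_predual hη t).nonneg (fun v w => ?_) ?_
  · simpa only [traceMul_rankOne] using
      (T.continuous_traceMul_predual η (rankOne ℂ w v)).tendsto t
  · simpa only [traceMul_one] using (T.continuous_traceMul_predual η 1).tendsto t

lemma intervalIntegrable_predual (hη : IsDensity η) (a b : ℝ) :
    IntervalIntegrable (fun s : ℝ => T.predual s.toNNReal η) MeasureTheory.volume a b :=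
  ((T.continuous_predual hη).comp continuous_real_toNNReal).intervalIntegrable a b

/-- The trajectory of `η` under the predual semigroup. -/
def orbit (η : TraceClass H) : Set (TraceClass H) := Set.range fun t => T.predual t η

lemma orbit_subset_setOf_isDensity (hη : IsDensity η) : T.orbit η ⊆ {σ | IsDensity σ} :=
  Set.range_subset_iff.2 (T.isDensity_predual hη)

lemma cesaroMean_mem_closedConvexHull_orbit (hη : IsDensity η) {t : ℝ} (ht : 0 < t) :
    T.cesaroMean η t ∈ closedConvexHull ℝ (T.orbit η) := by
  have cesaroMean_eq_average : T.cesaroMean η t = ⨍ s in (0 : ℝ)..t, T.predual s.toNNReal η := by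
    rw [interval_average_eq, sub_zero, cesaroMean]
  rw [cesaroMean_eq_average]
  refine convex_closedConvexHull.set_average_mem isClosed_closedConvexHull ?_ ?_
    (.of_forall fun s => subset_closedConvexHull ⟨s.toNNReal, rfl⟩)
    (intervalIntegrable_iff.1 (T.intervalIntegrable_predual hη 0 t))
  · simpa [Set.uIoc_of_le ht.le] using ht
  · simp [Set.uIoc_of_le ht.le]

lemma isDensity_cesaroMean (hη : IsDensity η) {t : ℝ} (ht : 0 < t) :
    IsDensity (T.cesaroMean η t) :=
  closedConvexHull_min (T.orbit_subset_setOf_isDensity hη) convex_setOf_isDensity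
    isClosed_setOf_isDensity (T.cesaroMean_mem_closedConvexHull_orbit hη ht)

lemma isTight_orbit (hρ : 0 ≤ ρ.toOp) (faithful : IsFaithful ρ)
    (invariant : T.IsInvariant ρ) (hη : 0 ≤ η.toOp) : IsTight (T.orbit η) := by
  intro ε hε
  obtain ⟨c, traceMul_le⟩ := exists_re_traceMul_le hρ faithful hη (half_pos hε)
  have tail_tendsto : Filter.Tendsto (fun F => c * (traceMul (1 - basisProj F) ρ).re)
      Filter.atTop (nhds 0) := by
    simpa using
      ((Complex.continuous_re.tendsto _).comp (tendsto_traceMul_one_sub_basisProj ρ)).const_mul c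
  obtain ⟨F, tail_le⟩ := (tail_tendsto.eventually_le_const (half_pos hε)).exists
  refine ⟨F, Set.forall_mem_range.2 fun s => ?_⟩
  have hQ := (isStarProjection_basisProj F).one_sub
  have map_le_one : T.map s (1 - basisProj F) ≤ 1 :=
    (OrderHomClass.mono (T.map s) hQ.le_one).trans_eq (T.map_one s)
  calc (traceMul (1 - basisProj F) (T.predual s η)).re
      = (traceMul (T.map s (1 - basisProj F)) η).re := by rw [traceMul_predual]
    _ ≤ ε / 2 + c * (traceMul (T.map s (1 - basisProj F)) ρ).re :=
        traceMul_le _ (map_nonneg (T.map s) hQ.nonneg) map_le_one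
    _ = ε / 2 + c * (traceMul (1 - basisProj F) ρ).re := by
        rw [← traceMul_predual, invariant s]
    _ ≤ ε / 2 + ε / 2 := by gcongr
    _ = ε := add_halves ε

lemma isCompact_closedConvexHull_orbit (hρ : 0 ≤ ρ.toOp) (faithful : IsFaithful ρ)
    (invariant : T.IsInvariant ρ) (hη : IsDensity η) :
    IsCompact (closedConvexHull ℝ (T.orbit η)) := by
  have orbit_density := T.orbit_subset_setOf_isDensity hη
  have orbit_bounded : Bornology.IsBounded (T.orbit η) :=
    isBounded_iff_forall_norm_le.2 ⟨1, fun σ hσ => (orbit_density hσ).norm_eq_one.le⟩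
  have orbit_totallyBounded : TotallyBounded (T.orbit η) :=
    totallyBounded_of_isTight (fun σ hσ => (orbit_density hσ).nonneg) orbit_bounded
      (T.isTight_orbit hρ faithful invariant hη.nonneg)
  rw [closedConvexHull_eq_closure_convexHull]
  exact orbit_totallyBounded.convexHull.closure.isCompact_of_isClosed isClosed_closure

lemma traceMul_map_cesaroMean (hη : IsDensity η) (x : H →L[ℂ] H) (r : ℝ≥0) {t : ℝ} (ht : 0 ≤ t) :
    traceMul (T.map r x) (T.cesaroMean η t) =
      traceMul x (t⁻¹ • ∫ s in (0 : ℝ)..t, T.predual (s + r).toNNReal η) := by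
  have shift_integrable : IntervalIntegrable (fun s : ℝ => T.predual (s + r).toNNReal η)
      MeasureTheory.volume 0 t :=
    (((T.continuous_predual hη).comp continuous_real_toNNReal).comp
      (continuous_add_const (r : ℝ))).intervalIntegrable 0 t
  rw [cesaroMean, ContinuousLinearMap.map_smul_of_tower, ContinuousLinearMap.map_smul_of_tower,
    ← ContinuousLinearMap.intervalIntegral_comp_comm _ (T.intervalIntegrable_predual hη 0 t),
    ← ContinuousLinearMap.intervalIntegral_comp_comm _ shift_integrable]
  congr 1
  refine intervalIntegral.integral_congr fun s hs => ?_
  have hs : 0 ≤ s := (Set.uIcc_of_le ht ▸ hs).1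
  simp only [traceMul_predual]
  rw [Real.toNNReal_add hs r.coe_nonneg, Real.toNNReal_coe, T.map_add]

lemma tendsto_traceMul_map_sub_traceMul_cesaroMean (hη : IsDensity η) (x : H →L[ℂ] H) (r : ℝ≥0) :
    Filter.Tendsto
      (fun t => traceMul (T.map r x) (T.cesaroMean η t) - traceMul x (T.cesaroMean η t))
      Filter.atTop (nhds 0) := by
  have shift_tendsto := ((traceMul x).continuous.tendsto _).comp
    (tendsto_inv_smul_integral_comp_add_sub
      ((T.continuous_predual hη).comp continuous_real_toNNReal)
      (fun s => (T.isDensity_predual hη s.toNNReal).norm_eq_one.le) (r : ℝ))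
  rw [_root_.map_zero] at shift_tendsto
  refine shift_tendsto.congr' ((Filter.eventually_ge_atTop 0).mono fun t ht => ?_)
  simp only [Function.comp_apply]
  rw [T.traceMul_map_cesaroMean hη x r ht, cesaroMean, ← map_sub, ← smul_sub]

lemma isInvariant_of_mapClusterPt_cesaroMean (hη : IsDensity η)
    (hσ : MapClusterPt σ Filter.atTop (T.cesaroMean η)) : T.IsInvariant σ := by
  refine fun r => ext_traceMul fun x => ?_
  rw [traceMul_predual, ← sub_eq_zero]
  have mapClusterPt_sub := hσ.continuousAt_comp
    (f := fun τ => traceMul (T.map r x) τ - traceMul x τ) (by fun_prop)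
  have tendsto_zero := T.tendsto_traceMul_map_sub_traceMul_cesaroMean hη x r
  exact eq_of_nhds_neBot (mapClusterPt_sub.clusterPt.mono tendsto_zero)

variable {T}

lemma IsInvariant.midpoint (hρ : T.IsInvariant ρ) (hσ : T.IsInvariant σ) :
    T.IsInvariant (midpoint ℝ ρ σ) := fun t => by
  rw [midpoint_eq_smul_add, predual_smul, predual_add, hρ t, hσ t]

lemma IsPrimitive.eq_of_isInvariant (hT : T.IsPrimitive) (hρ : IsDensity ρ)
    (faithful : IsFaithful ρ) (hρ_inv : T.IsInvariant ρ) (hσ : IsDensity σ)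
    (hσ_inv : T.IsInvariant σ) : σ = ρ := by
  have midpoint_density : IsDensity (midpoint ℝ ρ σ) := convex_setOf_isDensity.midpoint_mem hρ hσ
  have midpoint_faithful : IsFaithful (midpoint ℝ ρ σ) := by
    refine faithful.of_smul_le hρ.nonneg (c := ⅟2) (by norm_num) ?_
    rw [midpoint_eq_smul_add, LinearMap.map_smul_of_tower, _root_.map_add, smul_add]
    exact le_add_of_nonneg_right (smul_nonneg (by norm_num) hσ.nonneg)
  have midpoint_eq : midpoint ℝ ρ σ = ρ :=
    hT.unique ⟨midpoint_density, midpoint_faithful, hρ_inv.midpoint hσ_inv⟩ ⟨hρ, faithful, hρ_inv⟩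
  exact ((midpoint_eq_left_iff ℝ).1 midpoint_eq).symm

lemma IsPrimitive.tendsto_cesaroMean (hT : T.IsPrimitive) (hρ : IsDensity ρ)
    (faithful : IsFaithful ρ) (hρ_inv : T.IsInvariant ρ) (hη : IsDensity η) :
    Filter.Tendsto (T.cesaroMean η) Filter.atTop (nhds ρ) := by
  have compact := T.isCompact_closedConvexHull_orbit hρ.nonneg faithful hρ_inv hη
  refine compact.tendsto_nhds_of_unique_mapClusterPt ?_ fun σ hσ hσ_cluster => ?_
  · exact (Filter.eventually_gt_atTop 0).mono fun t ht =>
      T.cesaroMean_mem_closedConvexHull_orbit hη ht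
  · have σ_density : IsDensity σ := closedConvexHull_min (T.orbit_subset_setOf_isDensity hη)
      convex_setOf_isDensity isClosed_setOf_isDensity hσ
    exact hT.eq_of_isInvariant hρ faithful hρ_inv σ_density
      (T.isInvariant_of_mapClusterPt_cesaroMean hη hσ_cluster)

end QuantumMarkovSemigroup

end QuantumMarkov

end

theorem theorem5p4 {H : Type*} [NormedAddCommGroup H] [InnerProductSpace ℂ H] [CompleteSpace H]
    [TopologicalSpace.SeparableSpace H]
    (T : QuantumMarkov.QuantumMarkovSemigroup H) (hT : T.IsPrimitive)
    (ρ : QuantumMarkov.TraceClass H) (hρ : QuantumMarkov.IsDensity ρ)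
    (hρ_faithful : QuantumMarkov.IsFaithful ρ) (hρ_inv : T.IsInvariant ρ)
    (η : QuantumMarkov.TraceClass H) (hη : QuantumMarkov.IsDensity η) :
    (∀ t : ℝ, 0 < t →
      IntervalIntegrable (fun s : ℝ => T.predual s.toNNReal η) MeasureTheory.volume 0 t ∧
      QuantumMarkov.IsDensity (T.cesaroMean η t)) ∧
    Filter.Tendsto (T.cesaroMean η) Filter.atTop (nhds ρ) :=
  ⟨fun t ht => ⟨T.intervalIntegrable_predual hη 0 t, T.isDensity_cesaroMean hη ht⟩,
    hT.tendsto_cesaroMean hρ hρ_faithful hρ_inv hη⟩
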